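/- Let $\Gamma=(X,R)$ be a finite bipartite distance-regular graph with path-length distance $\partial$, diameter $D\ge 4$, intersection numbers $p^h_{ij}$ (for $\partial(x,y)=h$, the number of $z\in X$ with $\partial(x,z)=i$ and $\partial(z,y)=j$) and valency $k=p^0_{11}\ge 3$. Put $b_i=p^i_{1,i+1}$, $k_2=p^0_{22}$ and $d=\lfloor D/2\rfloor$. The adjacency matrix of $\Gamma$ has exactly $D+1$ distinct eigenvalues; denote them by $\theta_0>\theta_1>\cdots>\theta_D$. Fix $x\in X$ and let $\Gamma_2^2=\Gamma_2^2(x)$ be the graph with vertex set $\{y\in X:\partial(x,y)=2\}$ in which $y,z$ are adjacent if and only if $\partial(y,z)=2$. It has $k_2$ vertices, and the eigenvalues $\eta_1,\ldots,\eta_{k_2}$ of its adjacency matrix, listed with multiplicity, can be ordered so that $\eta_1=p^2_{22}$ and $\eta_i=b_3-1$ for $2\le i\le k$. Moreover $\theta_1^2\ne b_2$ and $\theta_d^2\ne b_2$, and for every such ordering $$\tilde\theta_1\le\eta_i\le\tilde\theta_d\qquad(k+1\le i\le k_2),$$ where $$\tilde\theta_1=-1-\frac{b_2b_3}{\theta_1^2-b_2},\qquad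 \tilde\theta_d=-1-\frac{b_2b_3}{\theta_d^2-b_2}.$$ -/

import Mathlib

namespace SimpleGraph

/-- `G` is a distance-regular graph with intersection numbers `p h i j` (usually written
`p^h_{ij}`): it is connected, and for `0 ≤ h, i, j ≤ D` (with `D` the diameter) and all vertices
`x, y` at distance `h`, there are exactly `p h i j` vertices `z` with `∂(x,z) = i` and
`∂(z,y) = j`. All values `p h i j` with `h, i, j ≤ D` are determined by `G`. -/
structure IsDistanceRegularWith {X : Type*} [Fintype X] (G : SimpleGraph X)
    (p : ℕ → ℕ → ℕ → ℕ) : Prop where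
  connected : G.Connected
  card_eq : ∀ h i j : ℕ, h ≤ G.diam → i ≤ G.diam → j ≤ G.diam →
    ∀ x y : X, G.dist x y = h →
      (Finset.univ.filter (fun z : X => G.dist x z = i ∧ G.dist z y = j)).card = p h i j

/-- The numbers `θ 0 > θ 1 > ⋯ > θ D` (with `D` the diameter) are exactly the distinct
eigenvalues of the adjacency matrix of `G`. Only the values `θ i` with `i ≤ D` matter. -/
structure IsEigenvalueSequence {X : Type*} [Fintype X] [DecidableEq X] (G : SimpleGraph X)
    [DecidableRel G.Adj] (θ : ℕ → ℝ) : Prop where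
  strictAnti : ∀ i j : ℕ, i < j → j ≤ G.diam → θ j < θ i
  mem_spectrum_iff : ∀ t : ℝ, t ∈ spectrum ℝ (G.adjMatrix ℝ) ↔ ∃ i ≤ G.diam, θ i = t

/-- The graph `Γ₂²(x)` on the vertices at distance `2` from `x`, two of them being adjacent
when they are at distance `2` in `G`. -/
def secondSubconstituentGraph {X : Type*} (G : SimpleGraph X) (x : X) :
    SimpleGraph {y : X // G.dist x y = 2} where
  Adj y z := G.dist (y : X) (z : X) = 2
  symm := ⟨fun y z h => by rw [SimpleGraph.dist_comm]; exact h⟩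
  loopless := ⟨fun y h => by simp at h⟩

noncomputable instance {X : Type*} (G : SimpleGraph X) (x : X) :
    DecidableRel (G.secondSubconstituentGraph x).Adj :=
  fun y z => inferInstanceAs (Decidable (G.dist (y : X) (z : X) = 2))

/-- `η 1, η 2, …, η k₂` are the local eigenvalues of `G` with respect to `x`, that is, the
eigenvalues, with multiplicity, of the adjacency matrix of `Γ₂²(x)`, ordered so that
`η 1 = p^2_{22}` and `η i = b₃ - 1` for `2 ≤ i ≤ k`. Here `k = p^0_{11}` is the valency,
`k₂ = p^0_{22}` is the second valency, and `b₃ = p^3_{14}`. -/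
structure IsLocalEigenvalueSequence {X : Type*} [Fintype X] [DecidableEq X] (G : SimpleGraph X)
    (p : ℕ → ℕ → ℕ → ℕ) (x : X) (η : ℕ → ℝ) : Prop where
  charpoly_eq : ((G.secondSubconstituentGraph x).adjMatrix ℝ).charpoly =
    ∏ i ∈ Finset.Icc 1 (p 0 2 2), (Polynomial.X - Polynomial.C (η i))
  one_eq : η 1 = (p 2 2 2 : ℝ)
  eq_of_le : ∀ i : ℕ, 2 ≤ i → i ≤ p 0 1 1 → η i = (p 3 1 4 : ℝ) - 1

end SimpleGraph

/-- `z̃ = -1 - b₂ b₃ / (z² - b₂)`, where `b₂ = p^2_{13}` and `b₃ = p^3_{14}`; it is meaningful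
for `z² ≠ b₂`. -/
noncomputable def tildeValue (p : ℕ → ℕ → ℕ → ℕ) (z : ℝ) : ℝ :=
  -1 - (p 2 1 3 : ℝ) * (p 3 1 4 : ℝ) / (z ^ 2 - (p 2 1 3 : ℝ))

/-! Write `k = p 0 1 1`, `b₂ = p 2 1 3`, `b₃ = p 3 1 4`, `c₂ = p 2 1 1`, `c₃ = p 3 1 2`, and let `A`
be the adjacency matrix of `G` and `M` that of the local graph. For an eigenvalue `θ` of `A` with
`θ² < k²`, the projection `E` onto its eigenspace is a polynomial in `A`, so its entries depend only
on distance: `E y z = β (∂(y,z))`. Two vertices of `Γ₂(x)` are at distance 0, 2 or 4, so on `Γ₂(x)`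
the matrix `E` is `(β 0 - β 4) I + (β 2 - β 4) M + β 4 J`. As `E` is positive semidefinite, an
eigenvector of `M` for `η` orthogonal to the all-ones vector gives `β 0 - β 4 + η (β 2 - β 4) ≥ 0`.
The three-term recurrence for `β` turns this, up to a positive factor, into `b₂ b₃ + (1 + η)(θ² -
b₂) ≥ 0` (`exists_dual_eigenvalue`, `local_eigenvalue_nonneg`).

Dividing by `θ² - b₂` bounds `η` from below or above according to its sign. That `θ_d² < b₂ < θ₁²`
follows by evaluating the quadratic form of `A² - t` at the difference of two unit vectors at
distance 2 (`mul_sub_pos_of_eigenvalue_sq`).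

The prescribed local eigenvalues come from the incidence matrix `N` between `Γ₂(x)` and `Γ(x)`: it
is injective and `M N = (c₃ - 1) J + (b₃ - 1) N`, so `N` maps sum-zero vectors to eigenvectors for
`b₃ - 1` (`le_roots_secondSubconstituentGraph`). -/

/-! ### Orthonormal eigenbases of real symmetric matrices -/

open Matrix in
/-- `φ` is an orthonormal basis of eigenvectors, with eigenvalues `l`, of the symmetric matrix
`M`. -/
structure Matrix.IsEigenbasis {n : Type*} [Fintype n] [DecidableEq n] (M : Matrix n n ℝ)
    (l : n → ℝ) (φ : n → n → ℝ) : Prop where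
  isSymm : M.IsSymm
  mulVec_eq : ∀ a, M *ᵥ φ a = l a • φ a
  orthonormal : ∀ a b, φ a ⬝ᵥ φ b = if a = b then 1 else 0
  sum_smul : ∀ v, ∑ a, (φ a ⬝ᵥ v) • φ a = v
  roots_charpoly : M.charpoly.roots = Finset.univ.val.map l

namespace Matrix

open Polynomial

variable {n : Type*} [Fintype n] [DecidableEq n] {M : Matrix n n ℝ} {l : n → ℝ} {φ : n → n → ℝ}

theorem IsSymm.exists_isEigenbasis (hM : M.IsSymm) : ∃ l φ, M.IsEigenbasis l φ := by
  have hH : M.IsHermitian := by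
    rw [IsHermitian, conjTranspose_eq_transpose_of_trivial]; exact hM
  refine ⟨hH.eigenvalues, fun a => ⇑(hH.eigenvectorBasis a), hM, hH.mulVec_eigenvectorBasis,
    fun a b => ?_, fun v => ?_, ?_⟩
  · have := (orthonormal_iff_ite.mp hH.eigenvectorBasis.orthonormal) a b
    rw [EuclideanSpace.inner_eq_star_dotProduct] at this
    rw [dotProduct_comm]
    simpa using this
  · have := hH.eigenvectorBasis.sum_repr (WithLp.toLp 2 v)
    have h2 := congrArg WithLp.ofLp this
    simp only [WithLp.ofLp_sum, WithLp.ofLp_smul] at h2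
    rw [← h2]
    refine Finset.sum_congr rfl fun a _ => ?_
    congr 1
    rw [OrthonormalBasis.repr_apply_apply, EuclideanSpace.inner_eq_star_dotProduct, h2,
      dotProduct_comm]
    simp
  · rw [hH.roots_charpoly_eq_eigenvalues]; rfl

namespace IsEigenbasis

variable (h : M.IsEigenbasis l φ)
include h

theorem dotProduct_eq_sum (v w : n → ℝ) : v ⬝ᵥ w = ∑ a, (φ a ⬝ᵥ v) * (φ a ⬝ᵥ w) := by
  conv_lhs => rw [← h.sum_smul v]
  simp [sum_dotProduct]

theorem ext {v w : n → ℝ} (hvw : ∀ a, φ a ⬝ᵥ v = φ a ⬝ᵥ w) : v = w := by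
  rw [← h.sum_smul v, ← h.sum_smul w]
  simp [hvw]

theorem dotProduct_mulVec_eq (a : n) (v : n → ℝ) : φ a ⬝ᵥ (M *ᵥ v) = l a * (φ a ⬝ᵥ v) := by
  rw [dotProduct_mulVec, ← mulVec_transpose, h.isSymm, h.mulVec_eq, smul_dotProduct, smul_eq_mul]

theorem dotProduct_aeval_mulVec_eq (f : ℝ[X]) (a : n) (v : n → ℝ) :
    φ a ⬝ᵥ (aeval M f *ᵥ v) = f.eval (l a) * (φ a ⬝ᵥ v) := by
  induction f using Polynomial.induction_on' generalizing v with
  | add p q hp hq => simp [add_mulVec, dotProduct_add, hp, hq, add_mul]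
  | monomial m c =>
    induction m generalizing v with
    | zero => simp [Algebra.algebraMap_eq_smul_one, smul_mulVec]
    | succ m ih =>
      simp only [aeval_monomial, eval_monomial, pow_succ] at ih ⊢
      rw [← mul_assoc, ← mulVec_mulVec, ih, h.dotProduct_mulVec_eq]
      ring

theorem dotProduct_aeval_mulVec (f : ℝ[X]) (v w : n → ℝ) :
    v ⬝ᵥ (aeval M f *ᵥ w) = ∑ a, f.eval (l a) * ((φ a ⬝ᵥ v) * (φ a ⬝ᵥ w)) := by
  rw [h.dotProduct_eq_sum]
  refine Finset.sum_congr rfl fun a _ => ?_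
  rw [h.dotProduct_aeval_mulVec_eq]
  ring

theorem aeval_eq_zero {f : ℝ[X]} (hf : ∀ a, f.eval (l a) = 0) : aeval M f = 0 := by
  refine Matrix.toLin'.injective (LinearMap.ext fun v => ?_)
  rw [toLin'_apply]
  exact h.ext fun a => by simp [h.dotProduct_aeval_mulVec_eq, hf]

theorem ne_zero (a : n) : φ a ≠ 0 := by
  intro h0
  have := h.orthonormal a a
  simp [h0] at this

theorem mem_spectrum_iff {t : ℝ} : t ∈ spectrum ℝ M ↔ ∃ a, l a = t := by
  rw [mem_spectrum_iff_isRoot_charpoly, ← mem_roots M.charpoly_monic.ne_zero, h.roots_charpoly]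
  simp

theorem dotProduct_eq_zero {t : ℝ} {v : n → ℝ} (hv : M *ᵥ v = t • v) {a : n} (ha : l a ≠ t) :
    φ a ⬝ᵥ v = 0 := by
  have := h.dotProduct_mulVec_eq a v
  rw [hv, dotProduct_smul, smul_eq_mul] at this
  have h2 : (l a - t) * (φ a ⬝ᵥ v) = 0 := by linarith
  exact (mul_eq_zero.mp h2).resolve_left (sub_ne_zero.mpr ha)

theorem mem_spectrum_of_mulVec_eq {t : ℝ} {v : n → ℝ} (hv : M *ᵥ v = t • v) (hv0 : v ≠ 0) :
    t ∈ spectrum ℝ M := by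
  rw [h.mem_spectrum_iff]
  by_contra! hne
  exact hv0 (h.ext fun a => by simp [h.dotProduct_eq_zero hv (hne a)])

theorem count_roots_charpoly (t : ℝ) :
    M.charpoly.roots.count t = (Finset.univ.filter fun a => l a = t).card := by
  rw [h.roots_charpoly, Multiset.count_map, Finset.card_def, Finset.filter_val]
  simp only [eq_comm]

theorem finrank_le_count_roots_charpoly (t : ℝ) (V : Submodule ℝ (n → ℝ))
    (hV : ∀ v ∈ V, M *ᵥ v = t • v) : Module.finrank ℝ V ≤ M.charpoly.roots.count t := by
  let T : V →ₗ[ℝ] ({a // l a = t} → ℝ) :=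
    { toFun := fun v a => φ a ⬝ᵥ (v : n → ℝ)
      map_add' := fun v w => by ext a; simp [dotProduct_add]
      map_smul' := fun c v => by ext a; simp [dotProduct_smul] }
  have hT : Function.Injective T := by
    rw [← LinearMap.ker_eq_bot, LinearMap.ker_eq_bot']
    intro v hv
    refine Subtype.ext (h.ext fun a => ?_)
    by_cases ha : l a = t
    · have h0 : φ a ⬝ᵥ (v : n → ℝ) = 0 := congrFun hv ⟨a, ha⟩
      simp [h0]
    · simp [h.dotProduct_eq_zero (hV v v.2) ha]
  have := LinearMap.finrank_le_finrank_of_injective hT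
  rw [Module.finrank_fintype_fun_eq_card, Fintype.card_subtype] at this
  rwa [h.count_roots_charpoly]

/-- An eigenspace of dimension at least 2 meets every hyperplane nontrivially. -/
theorem exists_eigenvector_orthogonal {t : ℝ} (ht : 2 ≤ M.charpoly.roots.count t) (w : n → ℝ) :
    ∃ v ≠ 0, M *ᵥ v = t • v ∧ w ⬝ᵥ v = 0 := by
  rw [h.count_roots_charpoly] at ht
  obtain ⟨a, ha, b, hb, hab⟩ := Finset.one_lt_card.mp ht
  simp only [Finset.mem_filter, Finset.mem_univ, true_and] at ha hb
  by_cases hwa : w ⬝ᵥ φ a = 0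
  · exact ⟨φ a, h.ne_zero a, ha ▸ h.mulVec_eq a, hwa⟩
  · refine ⟨(w ⬝ᵥ φ b) • φ a - (w ⬝ᵥ φ a) • φ b, fun h0 => hwa ?_, ?_, ?_⟩
    · have := congrArg (φ b ⬝ᵥ ·) h0
      simpa [dotProduct_sub, h.orthonormal, hab, Ne.symm hab] using this
    · rw [mulVec_sub, mulVec_smul, mulVec_smul, h.mulVec_eq, h.mulVec_eq, ha, hb, smul_sub,
        smul_comm t (w ⬝ᵥ φ b), smul_comm t (w ⬝ᵥ φ a)]
    · simp [dotProduct_sub]; ring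

end IsEigenbasis

end Matrix

/-! ### Distances in bipartite graphs and intersection numbers -/

namespace SimpleGraph

variable {X : Type*} {G : SimpleGraph X}

theorem Coloring.even_dist_iff (c : G.Coloring Bool) (hc : G.Connected) (y z : X) :
    Even (G.dist y z) ↔ c y = c z := by
  obtain ⟨w, hw⟩ := hc.exists_walk_length_eq_dist y z
  rw [← hw, c.even_length_iff_congr w, ← Bool.eq_iff_iff]

theorem IsBipartite.nonempty_coloring_bool (h : G.IsBipartite) : Nonempty (G.Coloring Bool) :=
  Nonempty.map (fun c => recolorOfEquiv G finTwoEquiv c) h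

/-- The triangle inequality allows a change of at most 1, and parity of distance excludes a change
of 0. -/
theorem Connected.dist_eq_succ_or_of_adj_of_coloring (hc : G.Connected) (c : G.Coloring Bool)
    {y w : X} (h : G.Adj y w) (z : X) :
    G.dist w z = G.dist y z + 1 ∨ G.dist w z + 1 = G.dist y z := by
  have h1 : G.dist y w = 1 := dist_eq_one_iff_adj.mpr h
  have h2 := hc.dist_triangle (u := y) (v := w) (w := z)
  have h3 := hc.dist_triangle (u := w) (v := y) (w := z)
  rw [dist_comm (u := w) (v := y)] at h3
  have h4 : G.dist y z ≠ G.dist w z := by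
    intro he
    have a := c.even_dist_iff hc y z
    have b := c.even_dist_iff hc w z
    have := c.valid h
    rw [he, b] at a
    revert a this
    cases c y <;> cases c z <;> cases c w <;> simp
  omega

theorem Connected.exists_adj_dist_eq (hc : G.Connected) {y z : X} {m : ℕ}
    (h : G.dist y z = m + 1) : ∃ w, G.Adj y w ∧ G.dist w z = m := by
  obtain ⟨p, hp⟩ := hc.exists_walk_length_eq_dist y z
  cases p with
  | nil => simp at h
  | @cons _ w _ hyw q =>
    refine ⟨w, hyw, ?_⟩
    have h1 := dist_le q
    have h2 := hc.dist_triangle (u := y) (v := w) (w := z)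
    rw [dist_eq_one_iff_adj.mpr hyw] at h2
    simp only [Walk.length_cons] at hp
    omega

namespace IsDistanceRegularWith

open Matrix Polynomial

variable [Fintype X] {p : ℕ → ℕ → ℕ → ℕ} (hG : G.IsDistanceRegularWith p)
include hG

theorem dist_le_diam (y z : X) : G.dist y z ≤ G.diam := by
  have := hG.connected.nonempty
  exact SimpleGraph.dist_le_diam (connected_iff_ediam_ne_top.mp hG.connected)

theorem exists_dist_eq {i : ℕ} (hi : i ≤ G.diam) : ∃ y z, G.dist y z = i := by
  induction hi using Nat.decreasingInduction with
  | self =>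
    have := hG.connected.nonempty
    exact G.exists_dist_eq_diam
  | of_succ k _ ih =>
    obtain ⟨y, z, h⟩ := ih
    obtain ⟨w, -, hw⟩ := hG.connected.exists_adj_dist_eq h
    exact ⟨w, z, hw⟩

theorem card_filter_adj [DecidableRel G.Adj] (hD : 1 ≤ G.diam) (y z : X) {j : ℕ}
    (hj : j ≤ G.diam) :
    (Finset.univ.filter fun w => G.Adj y w ∧ G.dist w z = j).card = p (G.dist y z) 1 j := by
  rw [← hG.card_eq _ 1 j (hG.dist_le_diam y z) hD hj y z rfl]
  congr 1
  ext w
  simp [dist_eq_one_iff_adj]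

theorem exists_dist_eq_right {i : ℕ} (hi : i ≤ G.diam) (y : X) : ∃ z, G.dist y z = i := by
  obtain ⟨u, v, huv⟩ := hG.exists_dist_eq hi
  have h1 := hG.card_eq 0 i i (Nat.zero_le _) hi hi u u (by simp)
  have h2 := hG.card_eq 0 i i (Nat.zero_le _) hi hi y y (by simp)
  have hne : 0 < (Finset.univ.filter fun z => G.dist y z = i ∧ G.dist z y = i).card := by
    rw [h2, ← h1]
    exact Finset.card_pos.mpr ⟨v, by simp [huv, dist_comm (u := v)]⟩
  obtain ⟨z, hz⟩ := Finset.card_pos.mp hne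
  exact ⟨z, (Finset.mem_filter.mp hz).2.1⟩

theorem pos_pred {m : ℕ} (hm : m + 1 ≤ G.diam) : 0 < p (m + 1) 1 m := by
  classical
  obtain ⟨y, z, h⟩ := hG.exists_dist_eq hm
  obtain ⟨w, hyw, hw⟩ := hG.connected.exists_adj_dist_eq h
  have := hG.card_filter_adj (by omega) y z (j := m) (by omega)
  rw [h] at this
  rw [← this]
  exact Finset.card_pos.mpr ⟨w, by simp [hyw, hw]⟩

theorem pos_succ {m : ℕ} (hm : m + 1 ≤ G.diam) : 0 < p m 1 (m + 1) := by
  classical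
  obtain ⟨y, z, h⟩ := hG.exists_dist_eq hm
  obtain ⟨w, hyw, hw⟩ := hG.connected.exists_adj_dist_eq h
  have := hG.card_filter_adj (by omega) w z hm
  rw [hw] at this
  rw [← this]
  exact Finset.card_pos.mpr ⟨y, by simp [hyw.symm, h]⟩

section

variable [DecidableRel G.Adj]

theorem degree_eq (hD : 1 ≤ G.diam) (y : X) : G.degree y = p 0 1 1 := by
  have := hG.card_filter_adj hD y y hD
  rw [dist_self] at this
  rw [← this, ← card_neighborFinset_eq_degree]
  congr 1
  ext w
  simpa [dist_eq_one_iff_adj] using fun h : G.Adj y w => h.symm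

theorem sum_adj_dist_zero (hD : 1 ≤ G.diam) (β : ℕ → ℝ) (y : X) :
    ∑ w, G.adjMatrix ℝ y w * β (G.dist w y) = p 0 1 1 * β 1 := by
  have : ∀ w, G.adjMatrix ℝ y w * β (G.dist w y) = if G.Adj y w then β 1 else 0 := by
    intro w
    by_cases h : G.Adj y w
    · simp [h, dist_eq_one_iff_adj.mpr h.symm]
    · simp [h]
  simp_rw [this]
  rw [Finset.sum_ite]
  simp only [Finset.sum_const_zero, add_zero, Finset.sum_const, nsmul_eq_mul]
  rw [← hG.degree_eq hD y, ← card_neighborFinset_eq_degree]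
  congr 3
  ext; simp

/-- Bipartiteness removes the middle term of the three-term recurrence. -/
theorem sum_adj_dist (hc : G.IsBipartite) (β : ℕ → ℝ) {y z : X} {m : ℕ} (h : G.dist y z = m + 1)
    (hm : m + 2 ≤ G.diam) :
    ∑ w, G.adjMatrix ℝ y w * β (G.dist w z) =
      p (m + 1) 1 m * β m + p (m + 1) 1 (m + 2) * β (m + 2) := by
  obtain ⟨c⟩ := hc.nonempty_coloring_bool
  have : ∀ w, G.adjMatrix ℝ y w * β (G.dist w z) =
      (if G.Adj y w ∧ G.dist w z = m then β m else 0) +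
      (if G.Adj y w ∧ G.dist w z = m + 2 then β (m + 2) else 0) := by
    intro w
    by_cases hw : G.Adj y w
    · rcases hG.connected.dist_eq_succ_or_of_adj_of_coloring c hw z with h1 | h1
      · have : G.dist w z = m + 2 := by omega
        simp [hw, this]
      · have : G.dist w z = m := by omega
        simp [hw, this]
    · simp [hw]
  simp_rw [this]
  rw [Finset.sum_add_distrib, Finset.sum_ite, Finset.sum_ite]
  simp only [Finset.sum_const_zero, add_zero, Finset.sum_const, nsmul_eq_mul]
  rw [hG.card_filter_adj (by omega) y z (by omega), hG.card_filter_adj (by omega) y z hm, h]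

theorem valency_eq (hc : G.IsBipartite) {m : ℕ} (hm : m + 2 ≤ G.diam) :
    (p 0 1 1 : ℝ) = p (m + 1) 1 m + p (m + 1) 1 (m + 2) := by
  obtain ⟨y, z, h⟩ := hG.exists_dist_eq (i := m + 1) (by omega)
  have h1 := hG.sum_adj_dist hc (fun _ => 1) h hm
  have h2 := hG.sum_adj_dist_zero (by omega) (fun _ => 1) y
  linarith

theorem one_one_zero (hD : 1 ≤ G.diam) : p 1 1 0 = 1 := by
  obtain ⟨y, z, h⟩ := hG.exists_dist_eq hD
  have := hG.card_filter_adj hD y z (Nat.zero_le _)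
  rw [h] at this
  rw [← this, Finset.card_eq_one]
  refine ⟨z, ?_⟩
  ext w
  simp only [Finset.mem_filter, Finset.mem_univ, true_and, Finset.mem_singleton,
    hG.connected.dist_eq_zero_iff]
  constructor
  · exact fun h => h.2
  · rintro rfl
    exact ⟨dist_eq_one_iff_adj.mp h, rfl⟩

/-- Matrices whose entries depend only on distance are stable under multiplication by `A`, since the
number of neighbours of `y` at distance `j` from `z` depends only on `∂(y,z)`. -/
theorem exists_aeval_eq [DecidableEq X] (hD : 1 ≤ G.diam) (f : ℝ[X]) :
    ∃ β : ℕ → ℝ, ∀ y z, aeval (G.adjMatrix ℝ) f y z = β (G.dist y z) := by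
  have key : ∀ (M : Matrix X X ℝ) (β : ℕ → ℝ), (∀ y z, M y z = β (G.dist y z)) →
      ∀ y z, (G.adjMatrix ℝ * M) y z =
        ∑ j ∈ Finset.range (G.diam + 1), p (G.dist y z) 1 j * β j := by
    intro M β hM y z
    rw [mul_apply]
    have : ∀ w, G.adjMatrix ℝ y w * M w z = ∑ j ∈ Finset.range (G.diam + 1),
        if G.Adj y w ∧ G.dist w z = j then β j else 0 := by
      intro w
      by_cases hw : G.Adj y w
      · have := hG.dist_le_diam w z
        simp [hw, hM, this]
      · simp [hw]
    simp_rw [this]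
    rw [Finset.sum_comm]
    refine Finset.sum_congr rfl fun j hj => ?_
    rw [Finset.sum_ite]
    simp only [Finset.sum_const_zero, add_zero, Finset.sum_const, nsmul_eq_mul]
    rw [hG.card_filter_adj hD y z (Nat.lt_succ_iff.mp (Finset.mem_range.mp hj))]
  induction f using Polynomial.induction_on' with
  | add f g hf hg =>
    obtain ⟨β, hβ⟩ := hf
    obtain ⟨γ, hγ⟩ := hg
    exact ⟨fun i => β i + γ i, fun y z => by simp [hβ, hγ]⟩
  | monomial m c =>
    induction m with
    | zero =>
      refine ⟨fun i => if i = 0 then c else 0, fun y z => ?_⟩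
      simp [Algebra.algebraMap_eq_smul_one, one_apply, hG.connected.dist_eq_zero_iff]
    | succ m ih =>
      obtain ⟨β, hβ⟩ := ih
      refine ⟨fun i => ∑ j ∈ Finset.range (G.diam + 1), p i 1 j * β j, fun y z => ?_⟩
      refine Eq.trans ?_ (key _ β hβ y z)
      simp only [aeval_monomial, pow_succ']
      rw [← mul_assoc, ← mul_assoc, Algebra.commutes]

theorem adjMatrix_sq_apply (hc : G.IsBipartite) (hD : 2 ≤ G.diam) (y z : X) :
    (G.adjMatrix ℝ * G.adjMatrix ℝ) y z =
      if G.dist y z = 0 then (p 0 1 1 : ℝ) else if G.dist y z = 2 then (p 2 1 1 : ℝ) else 0 := by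
  obtain ⟨c⟩ := hc.nonempty_coloring_bool
  have h1 : (G.adjMatrix ℝ * G.adjMatrix ℝ) y z = p (G.dist y z) 1 1 := by
    rw [← hG.card_filter_adj (by omega) y z (by omega), mul_apply]
    simp only [adjMatrix_apply, dist_eq_one_iff_adj]
    rw [Finset.card_eq_sum_ones, Finset.sum_filter]
    push_cast
    refine Finset.sum_congr rfl fun w _ => ?_
    by_cases hw : G.Adj y w <;> simp [hw]
  rw [h1]
  split_ifs with h0 h2
  · rw [h0]
  · rw [h2]
  · rw [← hG.card_filter_adj (by omega) y z (by omega)]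
    norm_cast
    rw [Finset.card_eq_zero, Finset.filter_eq_empty_iff]
    rintro w - ⟨hw, hw1⟩
    rcases hG.connected.dist_eq_succ_or_of_adj_of_coloring c hw z with h | h <;> omega

end

end IsDistanceRegularWith

end SimpleGraph

/-! ### Eigenvectors of `A`, quadratic forms and eigenspace projections -/

namespace SimpleGraph

open Matrix Polynomial

variable {X : Type*} {G : SimpleGraph X} [Fintype X] [DecidableRel G.Adj]

theorem adjMatrix_sq_nonneg (G : SimpleGraph X) [DecidableRel G.Adj] (y z : X) :
    0 ≤ (G.adjMatrix ℝ * G.adjMatrix ℝ) y z := by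
  rw [mul_apply]
  refine Finset.sum_nonneg fun w _ => ?_
  simp only [adjMatrix_apply]
  split_ifs <;> norm_num

theorem neg_mem_spectrum_adjMatrix [DecidableEq X] (hc : G.IsBipartite) {t : ℝ}
    (ht : t ∈ spectrum ℝ (G.adjMatrix ℝ)) : -t ∈ spectrum ℝ (G.adjMatrix ℝ) := by
  obtain ⟨c⟩ := hc.nonempty_coloring_bool
  obtain ⟨l, φ, h⟩ := (G.isSymm_adjMatrix (α := ℝ)).exists_isEigenbasis
  obtain ⟨a, rfl⟩ := h.mem_spectrum_iff.mp ht
  have hε : ∀ y z, G.Adj y z → (if c z then (1 : ℝ) else -1) = -(if c y then 1 else -1) := by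
    intro y z hyz
    have := c.valid hyz
    revert this
    cases c y <;> cases c z <;> simp
  -- Changing the sign of an eigenvector on one colour class negates its eigenvalue.
  refine h.mem_spectrum_of_mulVec_eq (v := fun y => (if c y then 1 else -1) * φ a y) ?_ ?_
  · ext y
    have := congrFun (h.mulVec_eq a) y
    rw [adjMatrix_mulVec_apply] at this ⊢
    simp only [Pi.smul_apply, smul_eq_mul] at this ⊢
    rw [Finset.sum_congr rfl fun z hz => by
      rw [hε y z ((mem_neighborFinset _ _ _).mp hz)], ← Finset.mul_sum, this]
    ring
  · intro h0
    refine h.ne_zero a (funext fun y => ?_)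
    have := congrFun h0 y
    simp only [Pi.zero_apply, mul_eq_zero] at this ⊢
    refine this.resolve_left ?_
    split_ifs <;> norm_num

namespace IsDistanceRegularWith

variable {p : ℕ → ℕ → ℕ → ℕ} (hG : G.IsDistanceRegularWith p)
include hG

theorem adjMatrix_mulVec_one (hD : 1 ≤ G.diam) :
    G.adjMatrix ℝ *ᵥ (fun _ => 1) = (p 0 1 1 : ℝ) • fun _ => 1 := by
  ext y
  rw [adjMatrix_mulVec_apply]
  simp [hG.degree_eq hD]

/-- This is the Laplacian form of the weighted graph `A²`, whose row sums are `k²`. Its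
nonnegativity gives `θ² ≤ k²`, and its vanishing forces an eigenvector with `θ² = k²` to agree on
vertices at distance 2. -/
theorem sum_adjMatrix_sq_mul_sub_sq (hD : 1 ≤ G.diam) {θ : ℝ} {φ : X → ℝ}
    (hφ : G.adjMatrix ℝ *ᵥ φ = θ • φ) :
    ∑ y, ∑ z, (G.adjMatrix ℝ * G.adjMatrix ℝ) y z * (φ y - φ z) ^ 2 =
      2 * ((p 0 1 1 : ℝ) ^ 2 - θ ^ 2) * (φ ⬝ᵥ φ) := by
  set B := G.adjMatrix ℝ * G.adjMatrix ℝ with hB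
  have hsymm : ∀ y z, B y z = B z y := by
    intro y z
    have : Bᵀ = B := by rw [hB, transpose_mul, transpose_adjMatrix]
    conv_rhs => rw [← this]
    rfl
  have hrow : ∀ y, ∑ z, B y z = (p 0 1 1 : ℝ) ^ 2 := by
    intro y
    have h1 : B *ᵥ (fun _ => (1 : ℝ)) = ((p 0 1 1 : ℝ) ^ 2) • fun _ => (1 : ℝ) := by
      rw [hB, ← mulVec_mulVec, hG.adjMatrix_mulVec_one hD, mulVec_smul,
        hG.adjMatrix_mulVec_one hD, smul_smul, sq]
    have := congrFun h1 y
    simpa [mulVec, dotProduct] using this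
  have hmul : ∀ y, ∑ z, B y z * φ z = θ ^ 2 * φ y := by
    intro y
    have h1 : B *ᵥ φ = (θ ^ 2) • φ := by
      rw [hB, ← mulVec_mulVec, hφ, mulVec_smul, hφ, smul_smul, sq]
    exact congrFun h1 y
  have e1 : ∑ y, ∑ z, B y z * φ y ^ 2 = (p 0 1 1 : ℝ) ^ 2 * (φ ⬝ᵥ φ) := by
    simp_rw [← Finset.sum_mul, hrow, dotProduct, Finset.mul_sum, sq]
  have e2 : ∑ y, ∑ z, B y z * φ z ^ 2 = (p 0 1 1 : ℝ) ^ 2 * (φ ⬝ᵥ φ) := by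
    rw [Finset.sum_comm, ← e1]
    exact Finset.sum_congr rfl fun y _ => Finset.sum_congr rfl fun z _ => by rw [hsymm]
  have e3 : ∑ y, ∑ z, φ y * (B y z * φ z) = θ ^ 2 * (φ ⬝ᵥ φ) := by
    simp_rw [← Finset.mul_sum, hmul, dotProduct, Finset.mul_sum]
    refine Finset.sum_congr rfl fun y _ => by ring
  have e4 : ∑ y, ∑ z, 2 * (φ y * (B y z * φ z)) = 2 * (θ ^ 2 * (φ ⬝ᵥ φ)) := by
    rw [← e3]
    simp_rw [Finset.mul_sum]
  have : ∀ y z, B y z * (φ y - φ z) ^ 2 =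
      B y z * φ y ^ 2 + B y z * φ z ^ 2 - 2 * (φ y * (B y z * φ z)) := fun y z => by ring
  simp_rw [this, Finset.sum_sub_distrib, Finset.sum_add_distrib, e1, e2, e4]
  ring

variable [DecidableEq X] {l : X → ℝ} {φ : X → X → ℝ}
  (h : (G.adjMatrix ℝ).IsEigenbasis l φ)
include h

theorem eigenvalue_sq_le (hD : 1 ≤ G.diam) (a : X) : l a ^ 2 ≤ (p 0 1 1 : ℝ) ^ 2 := by
  have h1 := hG.sum_adjMatrix_sq_mul_sub_sq hD (h.mulVec_eq a)
  rw [h.orthonormal a a, if_pos rfl] at h1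
  have h2 : 0 ≤ ∑ y, ∑ z, (G.adjMatrix ℝ * G.adjMatrix ℝ) y z * (φ a y - φ a z) ^ 2 :=
    Finset.sum_nonneg fun y _ => Finset.sum_nonneg fun z _ =>
      mul_nonneg (G.adjMatrix_sq_nonneg y z) (sq_nonneg _)
  linarith

theorem eigenvector_apply_eq (hc : G.IsBipartite) (hD : 2 ≤ G.diam) {a : X}
    (ha : l a ^ 2 = (p 0 1 1 : ℝ) ^ 2) {y z : X} (hyz : G.dist y z = 2) : φ a y = φ a z := by
  have h1 := hG.sum_adjMatrix_sq_mul_sub_sq (by omega) (h.mulVec_eq a)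
  rw [ha, sub_self, mul_zero, zero_mul] at h1
  have hnn : ∀ y z, 0 ≤ (G.adjMatrix ℝ * G.adjMatrix ℝ) y z * (φ a y - φ a z) ^ 2 :=
    fun y z => mul_nonneg (G.adjMatrix_sq_nonneg y z) (sq_nonneg _)
  rw [Finset.sum_eq_zero_iff_of_nonneg fun y _ => Finset.sum_nonneg fun z _ => hnn y z] at h1
  have h2 := h1 y (Finset.mem_univ _)
  rw [Finset.sum_eq_zero_iff_of_nonneg fun z _ => hnn y z] at h2
  have h3 := h2 z (Finset.mem_univ _)
  rw [hG.adjMatrix_sq_apply hc hD, hyz] at h3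
  have hpos : (0 : ℝ) < p 2 1 1 := by exact_mod_cast hG.pos_pred hD
  have h4 : (φ a y - φ a z) ^ 2 = 0 := by simpa [hpos.ne'] using h3
  exact sub_eq_zero.mp (pow_eq_zero_iff two_ne_zero |>.mp h4)

/-- For `∂(w,w') = 2` the vector `u = e_w - e_w'` is orthogonal to the eigenvectors with eigenvalue
`±k`, and `uᵀ(A² - t)u = 2(k - c₂ - t) = 2(b₂ - t)`. Only eigenvalues covered by the sign hypothesis
contribute to the spectral expansion. The lemma serves both `t = θ₁²` with `s = -1` and `t = θ_d²`
with `s = 1`. -/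
theorem mul_sub_pos_of_eigenvalue_sq (hc : G.IsBipartite) (hD : 4 ≤ G.diam) {s t : ℝ}
    (hs : s ≠ 0) (hst : ∀ a, l a ^ 2 ≠ (p 0 1 1 : ℝ) ^ 2 → 0 ≤ s * (l a ^ 2 - t)) :
    0 < s * ((p 2 1 3 : ℝ) - t) := by
  obtain ⟨y, w', h4⟩ := hG.exists_dist_eq hD
  obtain ⟨w₁, hyw, h3⟩ := hG.connected.exists_adj_dist_eq h4
  obtain ⟨w, hww, h2⟩ := hG.connected.exists_adj_dist_eq h3
  have hyw2 : G.dist y w = 2 := by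
    have e1 := hG.connected.dist_triangle (u := y) (v := w₁) (w := w)
    have e2 := hG.connected.dist_triangle (u := y) (v := w) (w := w')
    rw [dist_eq_one_iff_adj.mpr hyw, dist_eq_one_iff_adj.mpr hww] at e1
    omega
  have h2' : G.dist w' w = 2 := by rw [dist_comm]; exact h2
  have hwne : w ≠ w' := fun e => by simp [e] at h2
  have hyne : y ≠ w := fun e => by simp [e] at hyw2
  have hyne' : y ≠ w' := fun e => by simp [e] at h4
  set u : X → ℝ := Pi.single w 1 - Pi.single w' 1 with hu
  have hfA : aeval (G.adjMatrix ℝ) (Polynomial.X ^ 2 - C t : ℝ[X]) =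
      G.adjMatrix ℝ * G.adjMatrix ℝ - t • (1 : Matrix X X ℝ) := by
    simp [Algebra.algebraMap_eq_smul_one, sq]
  have hbk : (p 0 1 1 : ℝ) = p 2 1 1 + p 2 1 3 := hG.valency_eq hc (m := 1) (by omega)
  have hfu : ∀ z, (aeval (G.adjMatrix ℝ) (Polynomial.X ^ 2 - C t : ℝ[X]) *ᵥ u) z =
      (G.adjMatrix ℝ * G.adjMatrix ℝ) z w - (G.adjMatrix ℝ * G.adjMatrix ℝ) z w' - t * u z := by
    intro z
    rw [hfA, sub_mulVec, smul_mulVec, one_mulVec, hu, mulVec_sub, mulVec_single_one,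
      mulVec_single_one]
    simp
  have hquad := h.dotProduct_aeval_mulVec (Polynomial.X ^ 2 - C t) u u
  have hval : u ⬝ᵥ (aeval (G.adjMatrix ℝ) (Polynomial.X ^ 2 - C t : ℝ[X]) *ᵥ u) =
      2 * ((p 2 1 3 : ℝ) - t) := by
    conv_lhs => rw [hu]
    rw [sub_dotProduct, single_one_dotProduct, single_one_dotProduct, hfu, hfu]
    simp only [hG.adjMatrix_sq_apply hc (show 2 ≤ G.diam by omega), h2, h2', dist_self, hu]
    simp [hwne, hwne.symm]
    linarith
  have hterm : ∀ a, 0 ≤ s * ((Polynomial.X ^ 2 - C t : ℝ[X]).eval (l a) * ((φ a ⬝ᵥ u) * (φ a ⬝ᵥ u))) := by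
    intro a
    by_cases ha : l a ^ 2 = (p 0 1 1 : ℝ) ^ 2
    · have : φ a ⬝ᵥ u = 0 := by
        rw [hu, dotProduct_sub, dotProduct_single_one, dotProduct_single_one,
          hG.eigenvector_apply_eq h hc (by omega) ha h2, sub_self]
      simp [this]
    · rw [← mul_assoc]
      refine mul_nonneg ?_ (mul_self_nonneg _)
      simpa using hst a ha
  have hsum : ∑ a, s * ((Polynomial.X ^ 2 - C t : ℝ[X]).eval (l a) * ((φ a ⬝ᵥ u) * (φ a ⬝ᵥ u))) =
      2 * (s * ((p 2 1 3 : ℝ) - t)) := by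
    rw [← Finset.mul_sum, ← hquad, hval]; ring
  have h0 : 0 ≤ s * ((p 2 1 3 : ℝ) - t) := by
    have := Finset.sum_nonneg fun a (_ : a ∈ Finset.univ) => hterm a
    linarith
  -- Equality would make every spectral term vanish, hence `(A² - t)u = 0`. But at `y`, at distance
  -- 2 from `w` and 4 from `w'`, this vector takes the value `c₂ ≠ 0`.
  refine lt_of_le_of_ne h0 fun heq => ?_
  rw [← heq, mul_zero, Finset.sum_eq_zero_iff_of_nonneg fun a _ => hterm a] at hsum
  have hzero : aeval (G.adjMatrix ℝ) (Polynomial.X ^ 2 - C t : ℝ[X]) *ᵥ u = 0 := by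
    refine h.ext fun a => ?_
    rw [h.dotProduct_aeval_mulVec_eq, dotProduct_zero]
    have := hsum a (Finset.mem_univ _)
    simpa [hs] using this
  have hy := congrFun hzero y
  rw [hfu, hG.adjMatrix_sq_apply hc (by omega), hG.adjMatrix_sq_apply hc (by omega), hyw2, h4,
    hu] at hy
  have hpos : (0 : ℝ) < p 2 1 1 := by exact_mod_cast hG.pos_pred (m := 1) (by omega)
  simp [hyne, hyne', hpos.ne'] at hy

/-- The entries of the projection to the eigenspace of `l a` are given by a function `β` of the
distance, which satisfies the cosine recurrence and defines a positive semidefinite form. -/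
theorem exists_dual_eigenvalue (hc : G.IsBipartite) (hD : 4 ≤ G.diam) (hk : 2 ≤ p 0 1 1) (a : X)
    (ha : l a ^ 2 < (p 0 1 1 : ℝ) ^ 2) :
    ∃ β : ℕ → ℝ, (∀ v : X → ℝ, 0 ≤ ∑ y, v y * ∑ z, v z * β (G.dist y z)) ∧
      ∃ r > 0, β 0 - β 2 = r * (p 2 1 3 * p 3 1 4) ∧
        β 2 - β 4 = r * (l a ^ 2 - p 2 1 3) := by
  -- The Lagrange polynomial is 1 at `l a` and 0 at the other eigenvalues, so `f(A)` is the
  -- projection onto the eigenspace of `l a`.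
  set f : ℝ[X] := Lagrange.basis (Finset.univ.image l) id (l a) with hf
  have hmem : ∀ b, l b ∈ Finset.univ.image l := fun b => Finset.mem_image_of_mem _ (Finset.mem_univ _)
  have hf1 : f.eval (l a) = 1 := Lagrange.eval_basis_self (v := id) (Set.injOn_id _) (hmem a)
  have hf0 : ∀ b, l b ≠ l a → f.eval (l b) = 0 := fun b hb =>
    Lagrange.eval_basis_of_ne (v := id) (Ne.symm hb) (hmem b)
  have hfnn : ∀ b, 0 ≤ f.eval (l b) := by
    intro b
    by_cases hb : l b = l a
    · rw [hb, hf1]; exact zero_le_one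
    · rw [hf0 b hb]
  obtain ⟨β, hβ⟩ := hG.exists_aeval_eq (by omega) f
  have hquad : ∀ v : X → ℝ, ∑ y, v y * ∑ z, v z * β (G.dist y z) =
      ∑ b, f.eval (l b) * ((φ b ⬝ᵥ v) * (φ b ⬝ᵥ v)) := by
    intro v
    rw [← h.dotProduct_aeval_mulVec]
    simp only [dotProduct, mulVec, hβ]
    exact Finset.sum_congr rfl fun y _ => by simp only [mul_comm]
  have hpsd : ∀ v : X → ℝ, 0 ≤ ∑ y, v y * ∑ z, v z * β (G.dist y z) := fun v => by
    rw [hquad]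
    exact Finset.sum_nonneg fun b _ => mul_nonneg (hfnn b) (mul_self_nonneg _)
  have hmul : G.adjMatrix ℝ * aeval (G.adjMatrix ℝ) f = l a • aeval (G.adjMatrix ℝ) f := by
    have h0 : aeval (G.adjMatrix ℝ) ((Polynomial.X - C (l a)) * f) = 0 := by
      refine h.aeval_eq_zero fun b => ?_
      by_cases hb : l b = l a
      · simp [hb]
      · simp [hf0 b hb]
    rw [map_mul, map_sub, aeval_X, aeval_C, Algebra.algebraMap_eq_smul_one, sub_mul,
      smul_mul_assoc, one_mul, sub_eq_zero] at h0
    exact h0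
  have hrec : ∀ y z, ∑ w, G.adjMatrix ℝ y w * β (G.dist w z) = l a * β (G.dist y z) := by
    intro y z
    have := congrFun (congrFun hmul y) z
    rw [mul_apply] at this
    simpa [hβ] using this
  -- `β 0` is the diagonal entry of the projection at any vertex `y`; it is at least `φ a y ^ 2`,
  -- which is positive for a suitable `y`.
  have hpos : 0 < β 0 := by
    obtain ⟨y, hy⟩ := Function.ne_iff.mp (h.ne_zero a)
    have h1 := hquad (Pi.single y 1)
    have h2 : ∑ x, (Pi.single y 1 : X → ℝ) x *
        ∑ z, (Pi.single y 1 : X → ℝ) z * β (G.dist x z) = β 0 := by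
      simp [Pi.single_apply]
    rw [← h2, h1]
    refine Finset.sum_pos' (fun b _ => mul_nonneg (hfnn b) (mul_self_nonneg _))
      ⟨a, Finset.mem_univ _, ?_⟩
    rw [hf1, one_mul, dotProduct_single_one]
    exact mul_self_pos.mpr hy
  obtain ⟨y, z₃, h3⟩ := hG.exists_dist_eq (i := 3) (by omega)
  obtain ⟨z₁, h1⟩ := hG.exists_dist_eq_right (i := 1) (by omega) y
  obtain ⟨z₂, h2⟩ := hG.exists_dist_eq_right (i := 2) (by omega) y
  have r0 := hrec y y
  rw [hG.sum_adj_dist_zero (by omega), dist_self] at r0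
  have r1 := hrec y z₁
  rw [hG.sum_adj_dist hc β h1 (by omega), h1] at r1
  have r2 := hrec y z₂
  rw [hG.sum_adj_dist hc β h2 (by omega), h2] at r2
  have r3 := hrec y z₃
  rw [hG.sum_adj_dist hc β h3 (by omega), h3] at r3
  have v1 := hG.valency_eq hc (m := 0) (by omega)
  have v2 := hG.valency_eq hc (m := 1) (by omega)
  have v3 := hG.valency_eq hc (m := 2) (by omega)
  simp only [zero_add, Nat.reduceAdd, hG.one_one_zero (show 1 ≤ G.diam by omega),
    Nat.cast_one, one_mul] at r1 r2 r3 v1 v2 v3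
  have b2 : (0 : ℝ) < p 2 1 3 := by exact_mod_cast hG.pos_succ (m := 2) (by omega)
  have b3 : (0 : ℝ) < p 3 1 4 := by exact_mod_cast hG.pos_succ (m := 3) (by omega)
  have hk' : (2 : ℝ) ≤ p 0 1 1 := by exact_mod_cast hk
  generalize (p 0 1 1 : ℝ) = k at *
  generalize (p 2 1 3 : ℝ) = B2 at *
  generalize (p 3 1 4 : ℝ) = B3 at *
  generalize (p 2 1 1 : ℝ) = C2 at *
  generalize (p 3 1 2 : ℝ) = C3 at *
  generalize (p 1 1 2 : ℝ) = B1 at *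
  obtain rfl : C2 = k - B2 := by linarith
  obtain rfl : C3 = k - B3 := by linarith
  obtain rfl : B1 = k - 1 := by linarith
  have hk0 : (0 : ℝ) < k := by linarith
  have hk1 : (0 : ℝ) < k - 1 := by linarith
  have s1 : β 1 = l a * β 0 / k := by rw [eq_div_iff hk0.ne']; linarith
  have s2 : β 2 = (l a * β 1 - β 0) / (k - 1) := by rw [eq_div_iff hk1.ne']; linarith
  have s3 : β 3 = (l a * β 2 - (k - B2) * β 1) / B2 := by rw [eq_div_iff b2.ne']; linarith
  have s4 : β 4 = (l a * β 3 - (k - B3) * β 2) / B3 := by rw [eq_div_iff b3.ne']; linarith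
  -- Solving the recurrence up to `β 4` shows that both differences contain the factor `k² - θ²`.
  -- The remaining common factor is fixed by `β 0 - β 2 = β 0 (k² - θ²) / (k (k - 1))`.
  refine ⟨β, hpsd, β 0 * (k ^ 2 - l a ^ 2) / (k * (k - 1) * (B2 * B3)), ?_, ?_, ?_⟩
  · exact div_pos (mul_pos hpos (by linarith)) (by positivity)
  · rw [s2, s1]
    field_simp
    ring
  · rw [s4, s3, s2, s1]
    field_simp
    ring

end IsDistanceRegularWith

end SimpleGraph

/-! ### The `D + 1` distinct eigenvalues and their position relative to `b₂` -/

namespace SimpleGraph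

open Matrix Polynomial

section

variable {X : Type*} {G : SimpleGraph X} [Fintype X] [DecidableRel G.Adj] [DecidableEq X]

theorem adjMatrix_pow_apply_eq_zero {m : ℕ} {y z : X} (h : m < G.dist y z) :
    (G.adjMatrix ℝ ^ m) y z = 0 := by
  rw [adjMatrix_pow_apply_eq_card_walk, Nat.cast_eq_zero, Fintype.card_eq_zero_iff]
  exact ⟨fun w => absurd (dist_le w.1) (by have := w.2; simp only [Set.mem_ofPred_eq] at this; omega)⟩

theorem adjMatrix_pow_dist_apply_ne_zero (hc : G.Connected) (y z : X) :
    (G.adjMatrix ℝ ^ G.dist y z) y z ≠ 0 := by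
  rw [adjMatrix_pow_apply_eq_card_walk, Nat.cast_ne_zero, ← Nat.pos_iff_ne_zero,
    Fintype.card_pos_iff]
  obtain ⟨w, hw⟩ := hc.exists_walk_length_eq_dist y z
  exact ⟨⟨w, hw⟩⟩

namespace IsDistanceRegularWith

variable {p : ℕ → ℕ → ℕ → ℕ} (hG : G.IsDistanceRegularWith p)
include hG

theorem card_image_eigenvalues (hD : 1 ≤ G.diam) {l : X → ℝ} {φ : X → X → ℝ}
    (h : (G.adjMatrix ℝ).IsEigenbasis l φ) : (Finset.univ.image l).card = G.diam + 1 := by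
  set S := Finset.univ.image l with hS
  have hmem : ∀ a, l a ∈ S := fun a => Finset.mem_image_of_mem _ (Finset.mem_univ _)
  apply le_antisymm
  · obtain ⟨y, -⟩ := hG.exists_dist_eq (Nat.zero_le _)
    choose z hz using fun i : Fin (G.diam + 1) =>
      hG.exists_dist_eq_right (Nat.lt_succ_iff.mp i.2) y
    let T : degreeLT ℝ (G.diam + 2) →ₗ[ℝ] (Fin (G.diam + 1) → ℝ) :=
      { toFun := fun f i => aeval (G.adjMatrix ℝ) (f : ℝ[X]) y (z i)
        map_add' := fun f g => by ext i; simp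
        map_smul' := fun c f => by ext i; simp }
    -- Polynomials of degree at most `D + 1` form a space of dimension `D + 2`, while `f(A)` is
    -- determined by `D + 1` entries, one for each distance. So some nonzero `f` of this degree
    -- annihilates `A`, and every eigenvalue is a root of it.
    have hker : LinearMap.ker T ≠ ⊥ := by
      apply LinearMap.ker_ne_bot_of_finrank_lt
      rw [(degreeLTEquiv ℝ (G.diam + 2)).finrank_eq]
      simp
    obtain ⟨f, hf, hf0⟩ := (Submodule.ne_bot_iff _).mp hker
    obtain ⟨β, hβ⟩ := hG.exists_aeval_eq hD (f : ℝ[X])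
    have hAf : aeval (G.adjMatrix ℝ) (f : ℝ[X]) = 0 := by
      ext u v
      have h1 : aeval (G.adjMatrix ℝ) (f : ℝ[X]) y
          (z ⟨G.dist u v, Nat.lt_succ_iff.mpr (hG.dist_le_diam u v)⟩) = 0 :=
        congrFun (LinearMap.mem_ker.mp hf) _
      rw [hβ, hz] at h1
      rw [hβ, h1, Matrix.zero_apply]
    have hne : (f : ℝ[X]) ≠ 0 := fun e => hf0 (Subtype.ext e)
    have hroots : S.val ⊆ (f : ℝ[X]).roots := by
      intro t ht
      rw [Finset.mem_val, hS, Finset.mem_image] at ht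
      obtain ⟨a, -, rfl⟩ := ht
      rw [mem_roots hne]
      have := h.dotProduct_aeval_mulVec_eq (f : ℝ[X]) a (φ a)
      rw [hAf, h.orthonormal, if_pos rfl] at this
      simpa using this.symm
    have h1 := card_le_degree_of_subset_roots hroots
    have h2 := mem_degreeLT.mp f.2
    rw [degree_eq_natDegree hne] at h2
    have h3 : (f : ℝ[X]).natDegree < G.diam + 2 := by exact_mod_cast h2
    omega
  -- With `m ≤ D` distinct eigenvalues, a monic polynomial of degree `m` annihilates `A`. At a pair
  -- at distance `m` only the leading power has a nonzero entry, a contradiction.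
  · by_contra! hlt
    obtain ⟨y, z, hyz⟩ := hG.exists_dist_eq (i := S.card) (by omega)
    set f : ℝ[X] := ∏ t ∈ S, (Polynomial.X - C t) with hf
    have hmonic : f.Monic := monic_prod_of_monic _ _ fun t _ => monic_X_sub_C t
    have hdeg : f.natDegree = S.card := by
      rw [hf, natDegree_prod_of_monic _ _ fun t _ => monic_X_sub_C t]
      simp
    have h0 : aeval (G.adjMatrix ℝ) f = 0 := by
      refine h.aeval_eq_zero fun a => ?_
      rw [hf, eval_prod]
      exact Finset.prod_eq_zero (hmem a) (by simp)
    rw [aeval_eq_sum_range, Finset.sum_range_succ, hmonic.coeff_natDegree, one_smul, hdeg] at h0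
    have h1 := congrFun (congrFun h0 y) z
    rw [Matrix.add_apply, Matrix.sum_apply, Finset.sum_eq_zero fun i hi => ?_, zero_add,
      Matrix.zero_apply, ← hyz] at h1
    · exact adjMatrix_pow_dist_apply_ne_zero hG.connected y z h1
    · rw [Matrix.smul_apply, adjMatrix_pow_apply_eq_zero (by rw [hyz]; exact Finset.mem_range.mp hi),
        smul_zero]

theorem exists_isEigenvalueSequence (hD : 1 ≤ G.diam) : ∃ θ, G.IsEigenvalueSequence θ := by
  obtain ⟨l, φ, h⟩ := (G.isSymm_adjMatrix (α := ℝ)).exists_isEigenbasis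
  have hcard := hG.card_image_eigenvalues hD h
  set S := Finset.univ.image l with hS
  -- `orderEmbOfFin` enumerates increasingly, hence the reversed index.
  refine ⟨fun i => S.orderEmbOfFin hcard ⟨G.diam - i, by omega⟩, ?_, ?_⟩
  · intro i j hij hj
    apply (S.orderEmbOfFin hcard).strictMono
    rw [Fin.mk_lt_mk]
    omega
  · intro t
    have h1 : t ∈ spectrum ℝ (G.adjMatrix ℝ) ↔ t ∈ Set.range (S.orderEmbOfFin hcard) := by
      rw [h.mem_spectrum_iff, Finset.range_orderEmbOfFin, hS]
      simp
    rw [h1]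
    constructor
    · rintro ⟨i, rfl⟩
      refine ⟨G.diam - i, by omega, ?_⟩
      congr 1
      ext
      have := i.2
      simp only
      omega
    · rintro ⟨i, -, rfl⟩
      exact ⟨_, rfl⟩

end IsDistanceRegularWith

/-- The spectrum is symmetric about 0, so both sides, as functions of `i`, are its strictly
increasing enumeration. -/
theorem IsEigenvalueSequence.apply_sub_eq_neg {θ : ℕ → ℝ} (hθ : G.IsEigenvalueSequence θ)
    (hc : G.IsBipartite) {i : ℕ} (hi : i ≤ G.diam) : θ (G.diam - i) = -θ i := by
  let f : Fin (G.diam + 1) → ℝ := fun i => θ (G.diam - i)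
  let g : Fin (G.diam + 1) → ℝ := fun i => -θ i
  have hf : StrictMono f := fun i j hij => hθ.strictAnti _ _
    (by have := j.2; have : (i : ℕ) < j := hij; omega) (by omega)
  have hg : StrictMono g := fun i j hij =>
    neg_lt_neg (hθ.strictAnti _ _ hij (Nat.lt_succ_iff.mp j.2))
  have hrf : ∀ t, t ∈ Set.range f ↔ t ∈ spectrum ℝ (G.adjMatrix ℝ) := by
    intro t
    rw [hθ.mem_spectrum_iff]
    constructor
    · rintro ⟨i, rfl⟩
      exact ⟨G.diam - i, by omega, rfl⟩
    · rintro ⟨i, hi, rfl⟩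
      exact ⟨⟨G.diam - i, by omega⟩, by simp only [f]; congr 1; omega⟩
  have hrg : ∀ t, t ∈ Set.range g ↔ -t ∈ spectrum ℝ (G.adjMatrix ℝ) := by
    intro t
    rw [hθ.mem_spectrum_iff]
    constructor
    · rintro ⟨i, rfl⟩
      exact ⟨i, Nat.lt_succ_iff.mp i.2, by simp [g]⟩
    · rintro ⟨i, hi, hit⟩
      exact ⟨⟨i, by omega⟩, by simp [g, hit]⟩
  have : f = g := by
    refine (hf.range_inj hg).mp (Set.ext fun t => ?_)
    rw [hrf, hrg]
    exact ⟨neg_mem_spectrum_adjMatrix hc, fun h => by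
      simpa using neg_mem_spectrum_adjMatrix hc h⟩
  exact congrFun this ⟨i, by omega⟩

namespace IsDistanceRegularWith

variable {p : ℕ → ℕ → ℕ → ℕ} (hG : G.IsDistanceRegularWith p) {θ : ℕ → ℝ}
  (hθ : G.IsEigenvalueSequence θ)
include hG hθ

theorem eigenvalueSequence_zero (hD : 1 ≤ G.diam) : θ 0 = p 0 1 1 := by
  obtain ⟨l, φ, h⟩ := (G.isSymm_adjMatrix (α := ℝ)).exists_isEigenbasis
  have hanti : ∀ i ≤ G.diam, θ i ≤ θ 0 := by
    intro i hi
    rcases Nat.eq_zero_or_pos i with rfl | h0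
    · exact le_rfl
    · exact (hθ.strictAnti 0 i h0 hi).le
  apply le_antisymm
  · obtain ⟨a, ha⟩ := h.mem_spectrum_iff.mp ((hθ.mem_spectrum_iff _).mpr ⟨0, Nat.zero_le _, rfl⟩)
    rw [← ha]
    exact abs_le_of_sq_le_sq' (hG.eigenvalue_sq_le h hD a) (Nat.cast_nonneg _) |>.2
  · have hmem := h.mem_spectrum_of_mulVec_eq (hG.adjMatrix_mulVec_one hD) fun h0 => by
      obtain ⟨y, -⟩ := hG.exists_dist_eq (Nat.zero_le _)
      simpa using congrFun h0 y
    obtain ⟨i, hi, hi'⟩ := (hθ.mem_spectrum_iff _).mp hmem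
    rw [← hi']
    exact hanti i hi

variable (hc : G.IsBipartite)
include hc

theorem eigenvalueSequence_sq_lt {i : ℕ} (h0 : 0 < i) (hi : i < G.diam) :
    θ i ^ 2 < (p 0 1 1 : ℝ) ^ 2 := by
  have h1 := hG.eigenvalueSequence_zero hθ (by omega)
  have h2 := hθ.apply_sub_eq_neg hc (Nat.zero_le G.diam)
  have h3 := hθ.strictAnti 0 i h0 hi.le
  have h4 := hθ.strictAnti i G.diam hi le_rfl
  rw [Nat.sub_zero] at h2
  exact sq_lt_sq' (by linarith) (by linarith)

theorem exists_pos_lt_of_sq_ne {l : X → ℝ} {φ : X → X → ℝ}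
    (h : (G.adjMatrix ℝ).IsEigenbasis l φ) (hD : 1 ≤ G.diam) {a : X}
    (ha : l a ^ 2 ≠ (p 0 1 1 : ℝ) ^ 2) : ∃ i, 0 < i ∧ i < G.diam ∧ θ i = l a := by
  obtain ⟨i, hi, hi'⟩ := (hθ.mem_spectrum_iff _).mp (h.mem_spectrum_iff.mpr ⟨a, rfl⟩)
  have h1 := hG.eigenvalueSequence_zero hθ hD
  have h2 := hθ.apply_sub_eq_neg hc (Nat.zero_le G.diam)
  rw [Nat.sub_zero] at h2
  refine ⟨i, Nat.pos_of_ne_zero ?_, lt_of_le_of_ne hi ?_, hi'⟩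
  · rintro rfl
    rw [← hi', h1] at ha
    exact ha rfl
  · rintro rfl
    rw [← hi', h2, h1, neg_sq] at ha
    exact ha rfl

/-- Since `θ_{D-1} = -θ₁`, the value `θ₁²` is the largest square among the eigenvalues other than
`±k`. -/
theorem lt_eigenvalueSequence_one_sq (hD : 4 ≤ G.diam) : (p 2 1 3 : ℝ) < θ 1 ^ 2 := by
  obtain ⟨l, φ, h⟩ := (G.isSymm_adjMatrix (α := ℝ)).exists_isEigenbasis
  have := hG.mul_sub_pos_of_eigenvalue_sq h hc hD (s := -1) (t := θ 1 ^ 2) (by norm_num)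
    fun a ha => by
      obtain ⟨i, h0, hi, hia⟩ := hG.exists_pos_lt_of_sq_ne hθ hc h (by omega) ha
      have h1 : θ i ≤ θ 1 := by
        rcases (Nat.succ_le_of_lt h0).eq_or_lt with rfl | h1
        · exact le_rfl
        · exact (hθ.strictAnti 1 i h1 hi.le).le
      have h2 : -θ 1 ≤ θ i := by
        rw [← hθ.apply_sub_eq_neg hc (by omega)]
        rcases (Nat.le_sub_one_of_lt hi).eq_or_lt with rfl | h1
        · exact le_rfl
        · exact (hθ.strictAnti i _ h1 (by omega)).le
      have := sq_le_sq' h2 h1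
      rw [← hia]
      linarith
  linarith

/-- Here `θ_d ≥ 0` and `θ_{D-d} = -θ_d`. An index above `d` is at least `D - d`, so no eigenvalue
has a smaller square than `θ_d`. -/
theorem eigenvalueSequence_half_sq_lt (hD : 4 ≤ G.diam) :
    θ (G.diam / 2) ^ 2 < (p 2 1 3 : ℝ) := by
  obtain ⟨l, φ, h⟩ := (G.isSymm_adjMatrix (α := ℝ)).exists_isEigenbasis
  have hanti : ∀ i j, i ≤ j → j ≤ G.diam → θ j ≤ θ i := by
    intro i j hij hj
    rcases hij.eq_or_lt with rfl | hij
    · exact le_rfl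
    · exact (hθ.strictAnti i j hij hj).le
  have hneg := hθ.apply_sub_eq_neg hc (i := G.diam / 2) (by omega)
  have hnn : 0 ≤ θ (G.diam / 2) := by
    have := hanti (G.diam / 2) (G.diam - G.diam / 2) (by omega) (by omega)
    linarith
  have := hG.mul_sub_pos_of_eigenvalue_sq h hc hD (s := 1) (t := θ (G.diam / 2) ^ 2) (by norm_num)
    fun a ha => by
      obtain ⟨i, h0, hi, hia⟩ := hG.exists_pos_lt_of_sq_ne hθ hc h (by omega) ha
      rw [← hia, one_mul, sub_nonneg]
      rcases le_or_gt i (G.diam / 2) with h1 | h1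
      · exact pow_le_pow_left₀ hnn (hanti i _ h1 (by omega)) 2
      · have h2 := hanti (G.diam - G.diam / 2) i (by omega) hi.le
        rw [hneg] at h2
        rw [← neg_sq (θ i)]
        exact pow_le_pow_left₀ hnn (by linarith) 2
  linarith

end IsDistanceRegularWith

end

end SimpleGraph

/-! ### The local graph on `Γ₂(x)` and its eigenvalues -/

namespace SimpleGraph

open Matrix Polynomial

theorem _root_.List.prod_range_getD_eq_prod_map {M : Type*} [CommMonoid M] (f : ℝ → M)
    (L : List ℝ) : ∏ i ∈ Finset.range L.length, f (L.getD i 0) = (L.map f).prod := by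
  induction L with
  | nil => simp
  | cons a L ih => simp [Finset.prod_range_succ', ← ih, mul_comm]

theorem sum_subtype_eq_sum_ite {X : Type*} [Fintype X] (P : X → Prop) [DecidablePred P]
    (f : X → ℝ) : ∑ z : {z // P z}, f z = ∑ z, if P z then f z else 0 := by
  rw [← Finset.sum_filter]
  exact (Finset.sum_subtype _ (by simp) f).symm

section

variable {X : Type*} {G : SimpleGraph X}

theorem Connected.dist_eq_two_of_common_adj (hc : G.Connected) (c : G.Coloring Bool) {x w z : X}
    (hx : G.Adj w x) (hz : G.Adj w z) (hne : z ≠ x) : G.dist x z = 2 := by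
  have h1 := hc.dist_eq_succ_or_of_adj_of_coloring c hz x
  rw [dist_eq_one_iff_adj.mpr hx] at h1
  have h2 := hc.pos_dist_of_ne hne
  rw [dist_comm]
  omega

theorem Connected.dist_eq_two_or_four (hc : G.Connected) (c : G.Coloring Bool) {x y z : X}
    (hy : G.dist x y = 2) (hz : G.dist x z = 2) (hne : y ≠ z) :
    G.dist y z = 2 ∨ G.dist y z = 4 := by
  have h1 := hc.pos_dist_of_ne hne
  have h2 := hc.dist_triangle (u := y) (v := x) (w := z)
  rw [dist_comm (u := y) (v := x), hy, hz] at h2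
  have h3 : Even (G.dist y z) := by
    rw [c.even_dist_iff hc, ← (c.even_dist_iff hc x y).mp (by rw [hy]; exact even_two),
      (c.even_dist_iff hc x z).mp (by rw [hz]; exact even_two)]
  obtain ⟨m, hm⟩ := h3
  omega

variable {x : X}

theorem secondSubconstituentGraph_adjMatrix_apply (y z : {y : X // G.dist x y = 2}) :
    (G.secondSubconstituentGraph x).adjMatrix ℝ y z =
      if G.dist (y : X) (z : X) = 2 then 1 else 0 := by
  rw [adjMatrix_apply]
  rfl

/-- The incidence matrix between the vertices at distance `2` from `x` and the neighbours
of `x`. -/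
noncomputable def neighborIncMatrix (G : SimpleGraph X) [DecidableRel G.Adj] (x : X) :
    Matrix {y : X // G.dist x y = 2} {w : X // G.Adj x w} ℝ :=
  Matrix.of fun y w => G.adjMatrix ℝ w y

variable [Fintype X] [DecidableEq X]

namespace IsDistanceRegularWith

variable {p : ℕ → ℕ → ℕ → ℕ} (hG : G.IsDistanceRegularWith p)
include hG

omit [DecidableEq X] in
theorem secondSubconstituentGraph_mulVec_one (hD : 2 ≤ G.diam) :
    (G.secondSubconstituentGraph x).adjMatrix ℝ *ᵥ (fun _ => 1) =
      (p 2 2 2 : ℝ) • fun _ => 1 := by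
  ext y
  simp only [mulVec, dotProduct, mul_one, Pi.smul_apply, smul_eq_mul,
    secondSubconstituentGraph_adjMatrix_apply]
  rw [sum_subtype_eq_sum_ite (fun z => G.dist x z = 2)
    (fun z => if G.dist (y : X) z = 2 then 1 else 0), ← hG.card_eq 2 2 2 hD hD hD x y y.2,
    Finset.card_eq_sum_ones, Finset.sum_filter]
  push_cast
  refine Finset.sum_congr rfl fun z _ => ?_
  rw [dist_comm (u := z)]
  split_ifs <;> simp_all

variable [DecidableRel G.Adj]

/-- The entry counts neighbours of `w` at distance 2 from `y`, except `x`: all other neighbours of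
`w` lie in `Γ₂(x)`. As `∂(w,y)` is 1 or 3, the count is `k - 2` or `c₃ - 1`, and `k = b₃ + c₃`. -/
theorem secondSubconstituentGraph_mul_neighborIncMatrix_apply (hc : G.IsBipartite)
    (hD : 4 ≤ G.diam) (y : {y : X // G.dist x y = 2}) (w : {w : X // G.Adj x w}) :
    ((G.secondSubconstituentGraph x).adjMatrix ℝ * G.neighborIncMatrix x) y w =
      (p 3 1 2 - 1) + ((p 3 1 4 : ℝ) - 1) * G.neighborIncMatrix x y w := by
  obtain ⟨c⟩ := hc.nonempty_coloring_bool
  obtain ⟨y, hy⟩ := y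
  obtain ⟨w, hw⟩ := w
  have hpt : ∀ z, (if G.dist x z = 2 then
        (if G.dist y z = 2 then 1 else 0) * G.adjMatrix ℝ w z else 0) =
      (if G.Adj w z ∧ G.dist z y = 2 then (1 : ℝ) else 0) - if z = x then 1 else 0 := by
    intro z
    by_cases hzx : z = x
    · subst hzx
      simp [hw.symm, hy]
    · by_cases hwz : G.Adj w z
      · simp [hG.connected.dist_eq_two_of_common_adj c hw.symm hwz hzx, hwz, hzx,
          dist_comm (u := z)]
      · simp [hwz, hzx]
  have hsum : ((G.secondSubconstituentGraph x).adjMatrix ℝ * G.neighborIncMatrix x) ⟨y, hy⟩ ⟨w, hw⟩ =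
      p (G.dist w y) 1 2 - 1 := by
    simp only [mul_apply, secondSubconstituentGraph_adjMatrix_apply, neighborIncMatrix,
      Matrix.of_apply]
    rw [sum_subtype_eq_sum_ite (fun z => G.dist x z = 2)
      (fun z => (if G.dist y z = 2 then 1 else 0) * G.adjMatrix ℝ w z)]
    simp_rw [hpt]
    rw [Finset.sum_sub_distrib, ← hG.card_filter_adj (by omega) w y (by omega),
      Finset.card_eq_sum_ones, Finset.sum_filter]
    simp
  rw [hsum]
  have v1 := hG.valency_eq hc (m := 0) (by omega)
  have v3 := hG.valency_eq hc (m := 2) (by omega)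
  simp only [zero_add, Nat.reduceAdd, hG.one_one_zero (show 1 ≤ G.diam by omega),
    Nat.cast_one] at v1 v3
  simp only [neighborIncMatrix, Matrix.of_apply, adjMatrix_apply]
  rcases hG.connected.dist_eq_succ_or_of_adj_of_coloring c hw y with h | h
  · rw [hy] at h
    have : ¬ G.Adj w y := fun h' => by rw [dist_eq_one_iff_adj.mpr h'] at h; omega
    rw [h, if_neg this]
    simp
  · rw [hy] at h
    have h1 : G.dist w y = 1 := by omega
    rw [h1, if_pos (dist_eq_one_iff_adj.mp h1)]
    linarith

theorem transpose_neighborIncMatrix_mul_self_apply (hc : G.IsBipartite)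
    (hD : 3 ≤ G.diam) (w w' : {w : X // G.Adj x w}) :
    ((G.neighborIncMatrix x)ᵀ * G.neighborIncMatrix x) w w' =
      (if w = w' then (p 2 1 3 : ℝ) else 0) + (p 2 1 1 - 1) := by
  obtain ⟨c⟩ := hc.nonempty_coloring_bool
  obtain ⟨w, hw⟩ := w
  obtain ⟨w', hw'⟩ := w'
  have hpt : ∀ z, (if G.dist x z = 2 then G.adjMatrix ℝ w z * G.adjMatrix ℝ w' z else 0) =
      G.adjMatrix ℝ w z * G.adjMatrix ℝ z w' - if z = x then 1 else 0 := by
    intro z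
    by_cases hzx : z = x
    · subst hzx
      simp [hw.symm, hw']
    · by_cases hwz : G.Adj w z
      · simp [hG.connected.dist_eq_two_of_common_adj c hw.symm hwz hzx, hwz, hzx,
          adj_comm (u := z)]
      · simp [hwz, hzx]
  have hsum : ((G.neighborIncMatrix x)ᵀ * G.neighborIncMatrix x) ⟨w, hw⟩ ⟨w', hw'⟩ =
      (G.adjMatrix ℝ * G.adjMatrix ℝ) w w' - 1 := by
    simp only [mul_apply, transpose_apply, neighborIncMatrix, Matrix.of_apply]
    rw [sum_subtype_eq_sum_ite (fun z => G.dist x z = 2)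
      (fun z => G.adjMatrix ℝ w z * G.adjMatrix ℝ w' z)]
    simp_rw [hpt]
    rw [Finset.sum_sub_distrib]
    simp
  rw [hsum, hG.adjMatrix_sq_apply hc (by omega)]
  have v2 := hG.valency_eq hc (m := 1) (by omega)
  simp only [Nat.reduceAdd] at v2
  by_cases h : w = w'
  · subst h
    simp
    linarith
  · have h2 : G.dist w w' = 2 :=
      hG.connected.dist_eq_two_of_common_adj c hw hw' (Ne.symm h)
    simp [h2, h]

omit [DecidableEq X] in
theorem neighborIncMatrix_mulVec_one (hc : G.IsBipartite) (hD : 2 ≤ G.diam) :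
    G.neighborIncMatrix x *ᵥ (fun _ => 1) = (p 2 1 1 : ℝ) • fun _ => 1 := by
  ext ⟨y, hy⟩
  simp only [mulVec, dotProduct, mul_one, Pi.smul_apply, smul_eq_mul, neighborIncMatrix,
    Matrix.of_apply]
  rw [sum_subtype_eq_sum_ite (fun w => G.Adj x w) (fun w => G.adjMatrix ℝ w y)]
  have := hG.adjMatrix_sq_apply hc hD x y
  rw [hy, mul_apply] at this
  simp only [OfNat.ofNat_ne_zero, if_false, if_true] at this
  rw [← this]
  exact Finset.sum_congr rfl fun w _ => by
    simp only [adjMatrix_apply]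
    split_ifs <;> simp

/-- `NᵀN = b₂ I + (c₂ - 1) J` is positive definite, as `b₂ > 0` and `c₂ ≥ 1`. -/
theorem neighborIncMatrix_mulVecLin_injective (hc : G.IsBipartite) (hD : 3 ≤ G.diam) :
    Function.Injective (G.neighborIncMatrix x).mulVecLin := by
  rw [← LinearMap.ker_eq_bot, LinearMap.ker_eq_bot']
  intro u hu
  rw [mulVecLin_apply] at hu
  have h1 : u ⬝ᵥ (((G.neighborIncMatrix x)ᵀ * G.neighborIncMatrix x) *ᵥ u) =
      p 2 1 3 * (u ⬝ᵥ u) + (p 2 1 1 - 1) * (∑ w, u w) ^ 2 := by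
    simp only [dotProduct, mulVec, hG.transpose_neighborIncMatrix_mul_self_apply hc hD, add_mul,
      Finset.sum_add_distrib, ite_mul, zero_mul, Finset.sum_ite_eq, Finset.mem_univ, if_true,
      mul_add]
    rw [Finset.mul_sum, sq]
    congr 1
    · exact Finset.sum_congr rfl fun w _ => by ring
    · rw [← Finset.mul_sum, ← Finset.sum_mul]; ring
  rw [← mulVec_mulVec, hu, mulVec_zero, dotProduct_zero] at h1
  have b2 : (0 : ℝ) < p 2 1 3 := by exact_mod_cast hG.pos_succ (m := 2) (by omega)
  have c2 : (1 : ℝ) ≤ p 2 1 1 := by exact_mod_cast hG.pos_pred (m := 1) (by omega)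
  have h2 : 0 ≤ ((p 2 1 1 : ℝ) - 1) * (∑ w, u w) ^ 2 :=
    mul_nonneg (by linarith) (sq_nonneg _)
  have h3 : 0 ≤ u ⬝ᵥ u := Finset.sum_nonneg fun w _ => mul_self_nonneg _
  have h4 : u ⬝ᵥ u = 0 := by nlinarith
  exact dotProduct_self_eq_zero.mp h4

theorem secondSubconstituentGraph_mulVec_mulVec (hc : G.IsBipartite) (hD : 4 ≤ G.diam)
    (u : {w : X // G.Adj x w} → ℝ) :
    (G.secondSubconstituentGraph x).adjMatrix ℝ *ᵥ (G.neighborIncMatrix x *ᵥ u) =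
      (((p 3 1 2 : ℝ) - 1) * ∑ w, u w) • (fun _ => 1) +
        ((p 3 1 4 : ℝ) - 1) • (G.neighborIncMatrix x *ᵥ u) := by
  ext y
  rw [mulVec_mulVec]
  simp only [mulVec, dotProduct,
    hG.secondSubconstituentGraph_mul_neighborIncMatrix_apply hc hD, Pi.add_apply, Pi.smul_apply,
    smul_eq_mul, mul_one, Finset.mul_sum, ← Finset.sum_add_distrib]
  exact Finset.sum_congr rfl fun w _ => by ring

omit [DecidableEq X] in
theorem card_adj (hD : 1 ≤ G.diam) : Fintype.card {w : X // G.Adj x w} = p 0 1 1 := by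
  rw [← hG.degree_eq hD x, ← card_neighborFinset_eq_degree, Fintype.card_subtype]
  congr 1
  ext
  simp

/-- The all-ones vector has eigenvalue `p 2 2 2`, and the image under `N` of the sum-zero vectors is
a `(k - 1)`-dimensional space of eigenvectors for `b₃ - 1`. If the two eigenvalues coincide,
multiplicity `k` is needed for the common value. -/
theorem le_roots_secondSubconstituentGraph (hc : G.IsBipartite) (hD : 4 ≤ G.diam)
    (hk : 1 ≤ p 0 1 1) :
    (p 2 2 2 : ℝ) ::ₘ Multiset.replicate (p 0 1 1 - 1) ((p 3 1 4 : ℝ) - 1) ≤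
      ((G.secondSubconstituentGraph x).adjMatrix ℝ).charpoly.roots := by
  obtain ⟨l, φ, h⟩ := ((G.secondSubconstituentGraph x).isSymm_adjMatrix (α := ℝ)).exists_isEigenbasis
  have hinj := hG.neighborIncMatrix_mulVecLin_injective (x := x) hc (by omega)
  have hc2 : (0 : ℝ) < p 2 1 1 := by exact_mod_cast hG.pos_pred (m := 1) (by omega)
  obtain ⟨y₀, hy₀⟩ := hG.exists_dist_eq_right (i := 2) (by omega) x
  -- Two evaluations of `M N 1`, using `N 1 = c₂ 1`. When `p 2 2 2 = b₃ - 1` this forces `c₃ = 1`,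
  -- and then the whole `k`-dimensional image of `N` consists of eigenvectors.
  have hrel : (p 2 1 1 : ℝ) * p 2 2 2 =
      (p 3 1 2 - 1) * p 0 1 1 + (p 3 1 4 - 1) * p 2 1 1 := by
    have := congrFun (hG.secondSubconstituentGraph_mulVec_mulVec (x := x) hc hD fun _ => 1)
      ⟨y₀, hy₀⟩
    rw [hG.neighborIncMatrix_mulVec_one hc (by omega), mulVec_smul,
      hG.secondSubconstituentGraph_mulVec_one (by omega)] at this
    simpa [hG.card_adj (show 1 ≤ G.diam by omega)] using this
  by_cases hq : (p 2 2 2 : ℝ) = p 3 1 4 - 1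
  · have hc3 : ((p 3 1 2 : ℝ) - 1) = 0 := by
      have hk' : (p 0 1 1 : ℝ) ≠ 0 := by exact_mod_cast (by omega : p 0 1 1 ≠ 0)
      rw [hq] at hrel
      have : ((p 3 1 2 : ℝ) - 1) * p 0 1 1 = 0 := by linarith
      exact (mul_eq_zero.mp this).resolve_right hk'
    rw [hq, ← Multiset.replicate_succ, Nat.sub_add_cancel hk, ← Multiset.le_count_iff_replicate_le]
    have := h.finrank_le_count_roots_charpoly ((p 3 1 4 : ℝ) - 1)
      (LinearMap.range (G.neighborIncMatrix x).mulVecLin) (by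
        rintro _ ⟨u, rfl⟩
        rw [mulVecLin_apply, hG.secondSubconstituentGraph_mulVec_mulVec hc hD, hc3]
        simp)
    rwa [LinearMap.finrank_range_of_inj hinj, Module.finrank_fintype_fun_eq_card,
      hG.card_adj (by omega)] at this
  · rw [Multiset.le_iff_count]
    intro t
    rw [Multiset.count_cons, Multiset.count_replicate]
    by_cases ht : t = p 2 2 2
    · rw [if_neg (by rw [ht]; exact Ne.symm hq), if_pos ht, ht, zero_add,
        Multiset.one_le_count_iff_mem, mem_roots (charpoly_monic _).ne_zero,
        ← mem_spectrum_iff_isRoot_charpoly]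
      refine h.mem_spectrum_of_mulVec_eq (hG.secondSubconstituentGraph_mulVec_one (by omega)) ?_
      intro h0
      simpa using congrFun h0 ⟨y₀, hy₀⟩
    · rw [if_neg ht, add_zero]
      split_ifs with ht'
      · let s : ({w : X // G.Adj x w} → ℝ) →ₗ[ℝ] ℝ := ∑ w, LinearMap.proj w
        have hs : ∀ u, s u = ∑ w, u w := fun u => by simp [s]
        have h1 := h.finrank_le_count_roots_charpoly t
          ((LinearMap.ker s).map (G.neighborIncMatrix x).mulVecLin) (by
            rintro _ ⟨u, hu, rfl⟩
            have hu' : ∑ w, u w = 0 := by rw [← hs]; exact hu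
            rw [mulVecLin_apply, hG.secondSubconstituentGraph_mulVec_mulVec hc hD, hu', ht']
            simp)
        rw [← (Submodule.equivMapOfInjective _ hinj _).finrank_eq] at h1
        have h2 := s.finrank_range_add_finrank_ker
        rw [Module.finrank_fintype_fun_eq_card, hG.card_adj (by omega)] at h2
        have h3 := (LinearMap.range s).finrank_le
        rw [Module.finrank_self] at h3
        omega
      · exact Nat.zero_le _

omit [DecidableEq X] [DecidableRel G.Adj] in
theorem card_dist_eq_two (hD : 2 ≤ G.diam) :
    Fintype.card {y : X // G.dist x y = 2} = p 0 2 2 := by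
  rw [← hG.card_eq 0 2 2 (Nat.zero_le _) hD hD x x (by simp), Fintype.card_subtype]
  congr 1
  ext y
  simp [dist_comm (u := y)]

theorem exists_isLocalEigenvalueSequence (hc : G.IsBipartite) (hD : 4 ≤ G.diam)
    (hk : 1 ≤ p 0 1 1) (x : X) : ∃ η, G.IsLocalEigenvalueSequence p x η := by
  have hle := hG.le_roots_secondSubconstituentGraph (x := x) hc hD hk
  obtain ⟨l, φ, h⟩ := ((G.secondSubconstituentGraph x).isSymm_adjMatrix (α := ℝ)).exists_isEigenbasis
  set M := (G.secondSubconstituentGraph x).adjMatrix ℝ with hM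
  obtain ⟨r, hr⟩ := Multiset.le_iff_exists_add.mp hle
  set L : List ℝ := (p 2 2 2 : ℝ) :: (List.replicate (p 0 1 1 - 1) ((p 3 1 4 : ℝ) - 1) ++ r.toList)
    with hL
  have hLr : (L : Multiset ℝ) = M.charpoly.roots := by
    rw [hr, hL, ← Multiset.cons_coe, ← Multiset.coe_add, Multiset.coe_replicate,
      Multiset.coe_toList, Multiset.cons_add]
  have hcard : M.charpoly.roots.card = p 0 2 2 := by
    rw [h.roots_charpoly, Multiset.card_map, ← hG.card_dist_eq_two (x := x) (by omega)]
    rfl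
  have hlen : L.length = p 0 2 2 := by rw [← hcard, ← hLr, Multiset.coe_card]
  -- The list is indexed from 0 and `η` from 1; the default value is never reached for `1 ≤ i ≤ k₂`.
  refine ⟨fun i => L.getD (i - 1) 0, ?_, ?_, ?_⟩
  · have hsplit : M.charpoly = (M.charpoly.roots.map fun a => Polynomial.X - C a).prod := by
      refine (Polynomial.prod_multiset_X_sub_C_of_monic_of_roots_card_eq (charpoly_monic _) ?_).symm
      rw [hcard, charpoly_natDegree_eq_dim, hG.card_dist_eq_two (by omega)]
    rw [hsplit, ← hLr, ← hlen, ← Finset.Ico_add_one_right_eq_Icc,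
      Finset.prod_Ico_eq_prod_range, Multiset.map_coe, Multiset.prod_coe,
      ← List.prod_range_getD_eq_prod_map]
    simp only [Nat.add_sub_cancel, Nat.add_sub_cancel_left]
  · simp [hL]
  · intro i hi hik
    obtain ⟨j, rfl⟩ := Nat.exists_eq_add_of_le hi
    have h1 : 2 + j - 1 = j + 1 := by omega
    simp only [h1, hL, List.getD_cons_succ]
    rw [List.getD_append _ _ _ _ (by simp; omega), List.getD_replicate _ (by omega)]

/-- The eigenvalue inequality for eigenvectors orthogonal to the all-ones vector. -/
theorem local_eigenvalue_nonneg (hc : G.IsBipartite) (hD : 4 ≤ G.diam) (hk : 2 ≤ p 0 1 1)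
    {θ : ℝ} (hθ : θ ∈ spectrum ℝ (G.adjMatrix ℝ)) (hlt : θ ^ 2 < (p 0 1 1 : ℝ) ^ 2)
    {η : ℝ} {v : {y : X // G.dist x y = 2} → ℝ} (hv0 : v ≠ 0)
    (hv : (G.secondSubconstituentGraph x).adjMatrix ℝ *ᵥ v = η • v)
    (hv1 : (fun _ => 1) ⬝ᵥ v = 0) :
    0 ≤ (p 2 1 3 : ℝ) * p 3 1 4 + (1 + η) * (θ ^ 2 - p 2 1 3) := by
  obtain ⟨c⟩ := hc.nonempty_coloring_bool
  obtain ⟨l, φ, h⟩ := (G.isSymm_adjMatrix (α := ℝ)).exists_isEigenbasis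
  obtain ⟨a, rfl⟩ := h.mem_spectrum_iff.mp hθ
  obtain ⟨β, hpsd, r, hr, e1, e2⟩ := hG.exists_dual_eigenvalue h hc hD hk a hlt
  have hext : ∀ g : X → ℝ, ∑ y, (if hy : G.dist x y = 2 then v ⟨y, hy⟩ else 0) * g y =
      ∑ y : {y : X // G.dist x y = 2}, v y * g y := by
    intro g
    have := sum_subtype_eq_sum_ite (fun y => G.dist x y = 2)
      (fun y => (if hy : G.dist x y = 2 then v ⟨y, hy⟩ else 0) * g y)
    rw [Finset.sum_congr rfl fun y _ => by rw [dif_pos y.2]] at this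
    rw [this]
    refine Finset.sum_congr rfl fun y _ => ?_
    split_ifs <;> simp
  -- The positive semidefinite form is evaluated at `v` extended by zero outside `Γ₂(x)`.
  have h1 := hpsd fun y => if hy : G.dist x y = 2 then v ⟨y, hy⟩ else 0
  simp only [hext] at h1
  have h2 : ∀ y : {y : X // G.dist x y = 2}, ∑ z : {y : X // G.dist x y = 2},
      v z * β (G.dist (y : X) z) = (β 0 - β 4 + η * (β 2 - β 4)) * v y := by
    intro y
    -- Distances within `Γ₂(x)` are 0, 2 or 4, so the restricted form is a combination of `I`, `M`
    -- and `J`; the `J` term is killed by `hv1`.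
    have h3 : ∀ z : {y : X // G.dist x y = 2}, v z * β (G.dist (y : X) z) =
        (β 0 - β 4) * (if y = z then v z else 0) +
        (β 2 - β 4) * ((G.secondSubconstituentGraph x).adjMatrix ℝ y z * v z) +
        β 4 * (1 * v z) := by
      intro z
      rw [secondSubconstituentGraph_adjMatrix_apply]
      by_cases hyz : y = z
      · subst hyz; simp; ring
      · rcases hG.connected.dist_eq_two_or_four c y.2 z.2 (fun e => hyz (Subtype.ext e))
          with h4 | h4
        · simp [h4, hyz]; ring
        · simp [h4, hyz]; ring
    simp_rw [h3]
    have h4 : ∑ z, (G.secondSubconstituentGraph x).adjMatrix ℝ y z * v z = η * v y :=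
      congrFun hv y
    have h5 : ∑ z, 1 * v z = 0 := hv1
    rw [Finset.sum_add_distrib, Finset.sum_add_distrib, ← Finset.mul_sum, ← Finset.mul_sum,
      ← Finset.mul_sum, h4, h5, Finset.sum_ite_eq, if_pos (Finset.mem_univ _)]
    ring
  simp_rw [h2] at h1
  have h6 : ∑ y, v y * ((β 0 - β 4 + η * (β 2 - β 4)) * v y) =
      (β 0 - β 4 + η * (β 2 - β 4)) * (v ⬝ᵥ v) := by
    rw [dotProduct, Finset.mul_sum]
    exact Finset.sum_congr rfl fun y _ => by ring
  rw [h6] at h1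
  have h7 : 0 < v ⬝ᵥ v := by
    refine lt_of_le_of_ne (Finset.sum_nonneg fun w _ => mul_self_nonneg _) (Ne.symm ?_)
    exact fun e => hv0 (dotProduct_self_eq_zero.mp e)
  have h8 := nonneg_of_mul_nonneg_left h1 h7
  have h9 : β 0 - β 4 + η * (β 2 - β 4) =
      r * ((p 2 1 3 : ℝ) * p 3 1 4 + (1 + η) * (l a ^ 2 - p 2 1 3)) := by
    linear_combination e1 + (1 + η) * e2
  rw [h9] at h8
  exact nonneg_of_mul_nonneg_right h8 hr

-- If `η i ≠ p 2 2 2`, orthogonality to the all-ones vector is automatic. Otherwise the indices 1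
-- and `i` both carry the value `p 2 2 2`, so its eigenspace has dimension at least 2.
omit [DecidableRel G.Adj] in
theorem exists_local_eigenvector (hD : 2 ≤ G.diam) {η : ℕ → ℝ}
    (hη : G.IsLocalEigenvalueSequence p x η) {i : ℕ} (h2 : 2 ≤ i) (hi : i ≤ p 0 2 2) :
    ∃ v ≠ 0, (G.secondSubconstituentGraph x).adjMatrix ℝ *ᵥ v = η i • v ∧
      (fun _ => 1) ⬝ᵥ v = 0 := by
  obtain ⟨l, φ, h⟩ := ((G.secondSubconstituentGraph x).isSymm_adjMatrix (α := ℝ)).exists_isEigenbasis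
  have hroots : ((G.secondSubconstituentGraph x).adjMatrix ℝ).charpoly.roots =
      (Finset.Icc 1 (p 0 2 2)).val.map η := by
    rw [hη.charpoly_eq, roots_prod _ _ (Finset.prod_ne_zero_iff.mpr fun j _ => X_sub_C_ne_zero _)]
    simp
  by_cases hq : η i = p 2 2 2
  · apply h.exists_eigenvector_orthogonal
    rw [hroots, Multiset.count_map, ← Finset.filter_val, ← Finset.card_def]
    have : ({1, i} : Finset ℕ) ⊆ (Finset.Icc 1 (p 0 2 2)).filter fun j => η i = η j := by
      intro j hj
      rw [Finset.mem_insert, Finset.mem_singleton] at hj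
      rw [Finset.mem_filter, Finset.mem_Icc]
      rcases hj with rfl | rfl
      · exact ⟨⟨le_rfl, by omega⟩, by rw [hq, hη.one_eq]⟩
      · exact ⟨⟨by omega, hi⟩, rfl⟩
    have h3 := Finset.card_le_card this
    rwa [Finset.card_pair (by omega)] at h3
  · have hmem : η i ∈ ((G.secondSubconstituentGraph x).adjMatrix ℝ).charpoly.roots := by
      rw [hroots, Multiset.mem_map]
      exact ⟨i, by simp; omega, rfl⟩
    rw [mem_roots (charpoly_monic _).ne_zero, ← mem_spectrum_iff_isRoot_charpoly,
      h.mem_spectrum_iff] at hmem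
    obtain ⟨a, ha⟩ := hmem
    refine ⟨φ a, h.ne_zero a, by rw [h.mulVec_eq, ha], ?_⟩
    rw [dotProduct_comm]
    exact h.dotProduct_eq_zero (hG.secondSubconstituentGraph_mulVec_one hD) (by rw [ha]; exact hq)

end IsDistanceRegularWith

end

end SimpleGraph

/-! ### The bounds on the local eigenvalues -/

theorem mainTheorem1 {X : Type*} [Fintype X] [DecidableEq X] (G : SimpleGraph X)
    [DecidableRel G.Adj] (p : ℕ → ℕ → ℕ → ℕ) (hG : G.IsDistanceRegularWith p)
    (hbip : G.IsBipartite) (hD : 4 ≤ G.diam) (hk : 3 ≤ p 0 1 1) (x : X) :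
    (∃ θ : ℕ → ℝ, G.IsEigenvalueSequence θ) ∧
    (∃ η : ℕ → ℝ, G.IsLocalEigenvalueSequence p x η) ∧
    ∀ θ η : ℕ → ℝ, G.IsEigenvalueSequence θ → G.IsLocalEigenvalueSequence p x η →
      θ 1 ^ 2 ≠ (p 2 1 3 : ℝ) ∧ θ (G.diam / 2) ^ 2 ≠ (p 2 1 3 : ℝ) ∧
      ∀ i : ℕ, p 0 1 1 + 1 ≤ i → i ≤ p 0 2 2 →
        tildeValue p (θ 1) ≤ η i ∧ η i ≤ tildeValue p (θ (G.diam / 2)) := by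
  refine ⟨hG.exists_isEigenvalueSequence (by omega),
    hG.exists_isLocalEigenvalueSequence hbip hD (by omega) x, fun θ η hθ hη => ?_⟩
  have h1 := hG.lt_eigenvalueSequence_one_sq hθ hbip hD
  have hd := hG.eigenvalueSequence_half_sq_lt hθ hbip hD
  refine ⟨h1.ne', hd.ne, fun i hi hi' => ?_⟩
  obtain ⟨v, hv0, hv, hv1⟩ := hG.exists_local_eigenvector (by omega) hη (i := i) (by omega) hi'
  have key : ∀ j, 0 < j → j < G.diam →
      0 ≤ (p 2 1 3 : ℝ) * p 3 1 4 + (1 + η i) * (θ j ^ 2 - p 2 1 3) := fun j hj0 hj =>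
    hG.local_eigenvalue_nonneg hbip hD (by omega) ((hθ.mem_spectrum_iff _).mpr ⟨j, hj.le, rfl⟩)
      (hG.eigenvalueSequence_sq_lt hθ hbip hj0 hj) hv0 hv hv1
  have k1 := key 1 one_pos (by omega)
  have kd := key (G.diam / 2) (by omega) (by omega)
  -- `θ₁² - b₂ > 0` yields the lower bound; `θ_d² - b₂ < 0` reverses the inequality and yields the
  -- upper one.
  constructor
  · rw [tildeValue, sub_le_comm, le_div_iff₀ (by linarith)]
    linarith
  · rw [tildeValue, le_sub_comm, div_le_iff_of_neg (by linarith)]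
    linarith
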